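/- Let $k$ be an algebraically closed field of characteristic zero and let $\mathbb{D}_\infty=\langle g,x \mid x^2=1,\ xgx=g^{-1}\rangle$ be the infinite dihedral group, so that $\{g^ix^j \mid i\in\mathbb{Z},\ j\in\{0,1\}\}$ is a basis of the group algebra $k\mathbb{D}_\infty$. Let $(k\mathbb{D}_\infty)^\circ$ be the finite dual of the Hopf algebra $k\mathbb{D}_\infty$, that is, the set of all linear functionals on $k\mathbb{D}_\infty$ that vanish on some two-sided ideal of finite codimension; it is a subalgebra of $(k\mathbb{D}_\infty)^*$ under the convolution product, whose unit is the counit of $k\mathbb{D}_\infty$. For $\lambda\in k^*=k\setminus\{0\}$ let $E,\Phi_\lambda,\Psi_\lambda\in (k\mathbb{D}_\infty)^*$ be the linear functionals determined by $$E(g^ix^j)=i,\qquad \Phi_\lambda(g^ix^j)=\lambda^i,\qquad \Psi_\lambda(g^ix^j)=(-1)^j\lambda^i\qquad (i\in\mathbb{Z},\ j\in\{0,1\}).$$ Then $E$, $\Phi_\lambda$ and $\Psi_\lambda$ (for all $\lambda\in k^*$) lie in $(k\mathbb{D}_\infty)^\circ$ and generate it as a $k$-algebra: the subalgebra of $(k\mathbb{D}_\infty)^*$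 generated by $E$ and all $\Phi_\lambda,\Psi_\lambda$ is equal to $(k\mathbb{D}_\infty)^\circ$. -/

import Mathlib

noncomputable section

theorem finiteDimensional_quotient_ker {k H B : Type*} [Field k] [Ring H] [Algebra k H]
    [Ring B] [Algebra k B] [FiniteDimensional k B] (φ : H →ₐ[k] B) :
    FiniteDimensional k (H ⧸ RingHom.ker φ) := by
  have h : FiniteDimensional k (H ⧸ LinearMap.ker φ.toLinearMap) :=
    Module.Finite.of_injective _
      (LinearMap.ker_eq_bot.mp (Submodule.ker_liftQ_eq_bot' _ φ.toLinearMap rfl))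
  exact h

/-- The finite dual `H°` of a bialgebra `H` over a field `k`: the set of all linear functionals
on `H` that vanish on some two-sided ideal of finite codimension. It is a subalgebra of the full
dual `H →ₗ[k] k` under the convolution product `(f * f') (h) = ∑ f (h₁) * f' (h₂)`, whose unit is
the counit of `H`. -/
def finiteDual (k H : Type*) [Field k] [Ring H] [Bialgebra k H] :
    Subalgebra k (WithConv (H →ₗ[k] k)) where
  carrier := {f | ∃ I : Ideal H, I.IsTwoSided ∧ FiniteDimensional k (H ⧸ I) ∧ ∀ a ∈ I, f a = 0}
  mul_mem' := by
    rintro f f' ⟨I, hI, hfI, hf⟩ ⟨J, hJ, hfJ, hf'⟩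
    let φ : H →ₐ[k] TensorProduct k (H ⧸ I) (H ⧸ J) :=
      (Algebra.TensorProduct.map (Ideal.Quotient.mkₐ k I) (Ideal.Quotient.mkₐ k J)).comp
        (Bialgebra.comulAlgHom k H)
    refine ⟨RingHom.ker φ, inferInstance, finiteDimensional_quotient_ker φ, fun a ha => ?_⟩
    · let F : (H ⧸ I) →ₗ[k] k := (I.restrictScalars k).liftQ f.ofConv hf
      let F' : (H ⧸ J) →ₗ[k] k := (J.restrictScalars k).liftQ f'.ofConv hf'
      have key : (LinearMap.mul' k k ∘ₗ TensorProduct.map F F') ∘ₗ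
          (TensorProduct.map (Ideal.Quotient.mkₐ k I).toLinearMap
            (Ideal.Quotient.mkₐ k J).toLinearMap) =
          LinearMap.mul' k k ∘ₗ TensorProduct.map f.ofConv f'.ofConv := by
        ext x y
        rfl
      have h1 := LinearMap.congr_fun key (Coalgebra.comul a)
      have h2 : TensorProduct.map (Ideal.Quotient.mkₐ k I).toLinearMap
            (Ideal.Quotient.mkₐ k J).toLinearMap (Coalgebra.comul a) = 0 := ha
      rw [LinearMap.comp_apply, h2, map_zero] at h1
      exact h1.symm
  add_mem' := by
    rintro f f' ⟨I, hI, hfI, hf⟩ ⟨J, hJ, hfJ, hf'⟩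
    let φ : H →ₐ[k] (H ⧸ I) × (H ⧸ J) :=
      (Ideal.Quotient.mkₐ k I).prod (Ideal.Quotient.mkₐ k J)
    refine ⟨RingHom.ker φ, inferInstance, finiteDimensional_quotient_ker φ, fun a ha => ?_⟩
    have h : φ a = 0 := ha
    have hI : a ∈ I := Ideal.Quotient.eq_zero_iff_mem.mp (congrArg Prod.fst h)
    have hJ : a ∈ J := Ideal.Quotient.eq_zero_iff_mem.mp (congrArg Prod.snd h)
    have h : (f + f') a = f a + f' a := rfl
    rw [h, hf a hI, hf' a hJ, add_zero]
  algebraMap_mem' := by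
    intro c
    refine ⟨RingHom.ker (Bialgebra.counitAlgHom k H), inferInstance,
      finiteDimensional_quotient_ker _, fun a ha => ?_⟩
    have ha' : Coalgebra.counit (R := k) a = 0 := ha
    rw [LinearMap.convAlgebraMap_apply, ha', map_zero, smul_zero]

namespace InfiniteDihedral

/-- The infinite dihedral group `𝔻_∞`; Mathlib's `DihedralGroup 0`. -/
abbrev D : Type := DihedralGroup 0

/-- The generator `g` of infinite order of `𝔻_∞`. -/
def g : D := DihedralGroup.r 1

/-- The generator `x` of order two of `𝔻_∞`. -/
def x : D := DihedralGroup.sr 0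

theorem x_sq : x ^ 2 = 1 := rfl

theorem x_mul_g_mul_x : x * g * x = g⁻¹ := rfl

theorem g_zpow (i : ℤ) : g ^ i = DihedralGroup.r (n := 0) i := by
  have h := DihedralGroup.r_one_zpow (n := 0) i
  rwa [show ((i : ℤ) : ZMod 0) = i from Int.cast_id] at h

theorem g_zpow_mul_x (i : ℤ) : g ^ i * x = DihedralGroup.sr (n := 0) (-i : ℤ) := by
  rw [g_zpow]
  exact congrArg (DihedralGroup.sr (n := 0)) (zero_sub (i : ℤ))

/-- Every element of `𝔻_∞` is `g ^ i * x ^ j` for exactly one `i : ℤ` and one `j ∈ {0, 1}`. -/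
theorem normalForm_bijective :
    Function.Bijective fun p : ℤ × Fin 2 => g ^ p.1 * x ^ (p.2 : ℕ) := by
  constructor
  · rintro ⟨i, j⟩ ⟨i', j'⟩ h
    fin_cases j <;> fin_cases j' <;> simp [g_zpow_mul_x] at h
    · rw [g_zpow, g_zpow] at h
      injection h with h
      exact Prod.ext h rfl
    · rw [g_zpow] at h
      cases h
    · rw [g_zpow] at h
      cases h
    · injection h with h
      exact Prod.ext (neg_injective (G := ℤ) h) rfl
  · rintro (i | i)
    · exact ⟨((i : ℤ), 0), by simpa using g_zpow i⟩
    · refine ⟨(-(i : ℤ), 1), (g_zpow_mul_x (-(i : ℤ))).trans ?_⟩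
      exact congrArg (DihedralGroup.sr (n := 0)) (neg_neg (i : ℤ))

variable (k : Type*) [Field k]

/-- The basis `{g ^ i * x ^ j | i ∈ ℤ, j = 0, 1}` of the group algebra `k 𝔻_∞`. -/
def basis : Module.Basis (ℤ × Fin 2) k (MonoidAlgebra k D) :=
  (Module.Basis.ofRepr (MonoidAlgebra.coeffLinearEquiv k)).reindex
    (Equiv.ofBijective _ normalForm_bijective).symm

theorem basis_apply (i : ℤ) (j : Fin 2) :
    basis k (i, j) = MonoidAlgebra.of k D (g ^ i * x ^ (j : ℕ)) := by
  simp [basis, Module.Basis.reindex_apply]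

/-- `E = ∑ i, i (f_{i,0} + f_{i,1})`, where `f_{i,j}` is dual to the basis `g ^ i * x ^ j`;
that is, the functional with `g ^ i * x ^ j ↦ i`. -/
def E : WithConv (MonoidAlgebra k D →ₗ[k] k) :=
  WithConv.toConv ((basis k).constr k fun p => (p.1 : k))

variable {k}

/-- `Φ_c = ∑ i, c ^ i (f_{i,0} + f_{i,1})`, the functional with `g ^ i * x ^ j ↦ c ^ i`. -/
def Φ (c : kˣ) : WithConv (MonoidAlgebra k D →ₗ[k] k) :=
  WithConv.toConv ((basis k).constr k fun p => (c : k) ^ p.1)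

/-- `Ψ_c = ∑ i, c ^ i (f_{i,0} - f_{i,1})`, the functional with `g ^ i ↦ c ^ i` and
`g ^ i * x ↦ - c ^ i`. -/
def Ψ (c : kˣ) : WithConv (MonoidAlgebra k D →ₗ[k] k) :=
  WithConv.toConv ((basis k).constr k fun p => if p.2 = 0 then (c : k) ^ p.1 else -(c : k) ^ p.1)

end InfiniteDihedral

end

/-!
A functional on `k 𝔻_∞` is the function of its values on the basis `g ^ i * x ^ j`, and since the
basis elements are group-like, convolution is pointwise multiplication of these functions
(`ofValues`). So a functional is a pair of two-sided sequences, one for `j = 0` and one for `j = 1`.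

If `f` vanishes on a two-sided ideal `I` of finite codimension, then the image of `g` in the
quotient by `I` is a root of a monic polynomial `p`, so `p(g) ∈ I`, and therefore both sequences
`i ↦ f (g ^ i * x ^ j)` satisfy the linear recurrence `p(shift) = 0` (`orbit_mem_expPoly`). Over an
algebraically closed field of characteristic zero the solutions of such a recurrence are spanned by
the sequences `i (i - 1) ⋯ (i - m + 1) c ^ i` (`mem_expPoly_of_aeval_shift_eq_zero`): factoring `p`
reduces this to the facts that `shift - t` maps the space of exponential polynomials onto itself and
that its kernel lies in that space. As functionals not depending on `j`, these sequences are
polynomials in `E` times `Φ c`, while `(Φ 1 ± Ψ 1) / 2` are the indicators of `j = 0` and of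
`j = 1`; this writes `f` in terms of the generators.

Conversely, `E`, `Φ c` and `Ψ c` are combinations of matrix coefficients of two-dimensional
representations of `𝔻_∞`, so they vanish on the kernel of an algebra homomorphism to the 2 × 2
matrices.
-/

noncomputable section

namespace InfiniteDihedral

open Polynomial

/-! ### Linear recurrences for two-sided sequences -/

section Recurrence

variable (k : Type*) [Field k]

/-- The shift operator on two-sided sequences, `(shift a) i = a (i + 1)`. -/
def shift : Module.End k (ℤ → k) := LinearMap.funLeft k k (· + 1)

variable {k}

theorem shift_apply (a : ℤ → k) (i : ℤ) : shift k a i = a (i + 1) := rfl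

/-- The two-sided sequence `i ↦ i (i - 1) ⋯ (i - m + 1) c ^ i`. Falling factorials replace the
powers `i ^ m` because their differences are again falling factorials. -/
def fallingExp (m : ℕ) (c : kˣ) (i : ℤ) : k := (descPochhammer k m).eval (i : k) * (c : k) ^ i

variable (k) in
/-- The space of exponential polynomials, spanned by the sequences `fallingExp m c`. -/
def expPoly : Submodule k (ℤ → k) :=
  Submodule.span k (Set.range fun p : ℕ × kˣ => fallingExp p.1 p.2)

theorem fallingExp_mem (m : ℕ) (c : kˣ) : fallingExp m c ∈ expPoly k :=
  Submodule.subset_span ⟨(m, c), rfl⟩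

theorem shift_fallingExp_zero (c : kˣ) :
    shift k (fallingExp 0 c) = (c : k) • fallingExp 0 c := by
  ext i
  simp [shift_apply, fallingExp, zpow_add_one₀ c.ne_zero, mul_comm]

theorem shift_fallingExp_succ (m : ℕ) (c : kˣ) :
    shift k (fallingExp (m + 1) c) =
      (c : k) • (fallingExp (m + 1) c + ((m : k) + 1) • fallingExp m c) := by
  ext i
  have h := congrArg (Polynomial.eval ((i : k) + 1)) (descPochhammer_succ_comp_X_sub_one (R := k) m)
  simp at h
  simp only [shift_apply, fallingExp, Pi.smul_apply, Pi.add_apply, smul_eq_mul,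
    zpow_add_one₀ c.ne_zero, Int.cast_add, Int.cast_one, h]
  ring

/-- `shift - t` is surjective on exponential polynomials: it lowers `m` by one on `fallingExp m t`,
and for `c ≠ t` it multiplies `fallingExp m c` by `c - t` up to a term with smaller `m`. -/
theorem fallingExp_mem_map_shift_sub [CharZero k] (t : k) (m : ℕ) (c : kˣ) :
    fallingExp m c ∈ (expPoly k).map (shift k - algebraMap k _ t) := by
  by_cases hc : (c : k) = t
  · subst hc
    have hm : (c : k) * ((m : k) + 1) ≠ 0 :=
      mul_ne_zero c.ne_zero (Nat.cast_add_one_ne_zero m)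
    rw [← Submodule.smul_mem_iff _ hm]
    refine ⟨_, fallingExp_mem (m + 1) c, ?_⟩
    rw [LinearMap.sub_apply, shift_fallingExp_succ, Module.algebraMap_end_apply]
    module
  · have hc' : (c : k) - t ≠ 0 := sub_ne_zero.mpr hc
    rw [← Submodule.smul_mem_iff _ hc']
    induction m with
    | zero =>
      refine ⟨_, fallingExp_mem 0 c, ?_⟩
      rw [LinearMap.sub_apply, shift_fallingExp_zero, Module.algebraMap_end_apply]
      module
    | succ m ih =>
      rw [Submodule.smul_mem_iff _ hc'] at ih
      have h : (shift k - algebraMap k _ t) (fallingExp (m + 1) c) -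
          ((c : k) * ((m : k) + 1)) • fallingExp m c = ((c : k) - t) • fallingExp (m + 1) c := by
        rw [LinearMap.sub_apply, shift_fallingExp_succ, Module.algebraMap_end_apply]
        module
      rw [← h]
      exact sub_mem ⟨_, fallingExp_mem (m + 1) c, rfl⟩ (Submodule.smul_mem _ _ ih)

theorem mem_expPoly_of_shift_eq_smul {t : k} {a : ℤ → k} (h : shift k a = t • a) :
    a ∈ expPoly k := by
  have h' (i : ℤ) : a (i + 1) = t * a i := congrFun h i
  -- For `t = 0` there is no sequence `t ^ i`, but the shift is injective on two-sided sequences.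
  by_cases ht : t = 0
  · have : a = 0 := by
      ext i
      simpa [ht] using h' (i - 1)
    rw [this]
    exact zero_mem _
  · have ha : a = a 0 • fallingExp 0 (Units.mk0 t ht) := by
      ext i
      have : a i = a 0 * t ^ i := by
        induction i with
        | zero => simp
        | succ i ih => rw [h', ih, zpow_add_one₀ ht]; ring
        | pred i ih =>
          have h1 := h' (-(i : ℤ) - 1)
          rw [sub_add_cancel, ih] at h1
          apply mul_left_cancel₀ ht
          rw [← h1, zpow_sub_one₀ ht]
          field_simp
      simpa [fallingExp] using this
    rw [ha]
    exact Submodule.smul_mem _ _ (fallingExp_mem _ _)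

theorem mem_expPoly_of_shift_sub_mem [CharZero k] {t : k} {a : ℤ → k}
    (h : (shift k - algebraMap k _ t) a ∈ expPoly k) : a ∈ expPoly k := by
  have hle : expPoly k ≤ (expPoly k).map (shift k - algebraMap k _ t) := by
    refine Submodule.span_le.mpr ?_
    rintro _ ⟨p, rfl⟩
    exact fallingExp_mem_map_shift_sub t p.1 p.2
  obtain ⟨b, hb, hab⟩ := hle h
  rw [← sub_add_cancel a b]
  refine add_mem (mem_expPoly_of_shift_eq_smul (t := t) ?_) hb
  have h0 : (shift k - algebraMap k _ t) (a - b) = 0 := by rw [map_sub, hab, sub_self]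
  rwa [LinearMap.sub_apply, Module.algebraMap_end_apply, sub_eq_zero] at h0

/-- Over an algebraically closed field of characteristic zero, the solutions of a linear recurrence
with constant coefficients are exponential polynomials. -/
theorem mem_expPoly_of_aeval_shift_eq_zero [IsAlgClosed k] [CharZero k] {p : k[X]}
    (hp : p.Monic) {a : ℤ → k} (h : aeval (shift k) p a = 0) : a ∈ expPoly k := by
  rw [(IsAlgClosed.splits p).eq_prod_roots_of_monic hp] at h
  generalize p.roots = s at h
  induction s using Multiset.induction_on generalizing a with
  | empty =>
    have : a = 0 := by simpa using h
    rw [this]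
    exact zero_mem _
  | cons t s ih =>
    apply mem_expPoly_of_shift_sub_mem (t := t)
    apply ih
    rwa [Multiset.map_cons, Multiset.prod_cons, mul_comm, map_mul, map_sub, aeval_X, aeval_C] at h

end Recurrence

/-- The orbit sequence `i ↦ f (u ^ i * y)` turns multiplication by `u` into the shift, so it
satisfies the recurrence of every polynomial relation of `u` modulo the kernel of `f`. -/
theorem aeval_shift_orbit {k A : Type*} [Field k] [Ring A] [Algebra k A] (f : A →ₗ[k] k) (u : Aˣ)
    (p : k[X]) (y : A) (i : ℤ) :
    aeval (shift k) p (fun i : ℤ => f (↑(u ^ i) * y)) i = f (aeval (u : A) p * (↑(u ^ i) * y)) := by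
  induction p using Polynomial.induction_on' generalizing i with
  | add p q hp hq => simp [hp, hq, add_mul]
  | monomial n c =>
    have h (n : ℕ) (a : ℤ → k) (i : ℤ) : (shift k ^ n) a i = a (i + n) := by
      induction n generalizing i with
      | zero => simp
      | succ n ih =>
        rw [pow_succ', Module.End.mul_apply, shift_apply, ih]
        congr 1
        push_cast
        ring
    rw [aeval_monomial, aeval_monomial, Module.End.mul_apply, Module.algebraMap_end_apply,
      Pi.smul_apply, h, add_comm i, zpow_add, zpow_natCast, Units.val_mul, Units.val_pow_eq_pow_val,
      ← map_smul, Algebra.smul_def, mul_assoc, mul_assoc]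

end InfiniteDihedral

/-! ### Functionals on bialgebras and on the group algebra -/

/-- A functional is in the finite dual as soon as it factors through an algebra homomorphism to a
finite-dimensional algebra. -/
theorem mem_finiteDual_of_algHom {k H B : Type*} [Field k] [Ring H] [Bialgebra k H] [Ring B]
    [Algebra k B] [FiniteDimensional k B] (φ : H →ₐ[k] B) (ℓ : B →ₗ[k] k)
    {f : WithConv (H →ₗ[k] k)} (h : f.ofConv = ℓ ∘ₗ φ.toLinearMap) : f ∈ finiteDual k H := by
  refine ⟨RingHom.ker φ, inferInstance, finiteDimensional_quotient_ker φ, fun a ha => ?_⟩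
  have h1 : f a = ℓ (φ a) := LinearMap.congr_fun h a
  rw [h1, show φ a = 0 from ha, map_zero]

namespace InfiniteDihedral

open Polynomial

variable {k : Type*} [Field k]

variable (k) in
/-- The functional with prescribed values on the basis `g ^ i * x ^ j`. The basis consists of
group-like elements, so convolution of functionals is pointwise multiplication of values. -/
def ofValues : (ℤ × Fin 2 → k) →ₐ[k] WithConv (MonoidAlgebra k D →ₗ[k] k) :=
  AlgHom.ofLinearMap
    ((WithConv.linearEquiv k (MonoidAlgebra k D →ₗ[k] k)).symm.toLinearMap ∘ₗ
      ((basis k).constr k).toLinearMap)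
    (by
      apply WithConv.ofConv_injective
      refine (basis k).ext fun p => ?_
      refine ((basis k).constr_basis k _ p).trans ?_
      rw [basis_apply]
      simp [LinearMap.convOne_def])
    (fun a b => by
      apply WithConv.ofConv_injective
      refine (basis k).ext fun p => ?_
      refine ((basis k).constr_basis k _ p).trans ?_
      refine Eq.trans ?_ (LinearMap.convMul_apply _ _ _).symm
      have ha := (basis k).constr_basis k a p
      have hb := (basis k).constr_basis k b p
      rw [basis_apply, MonoidAlgebra.of_apply] at ha hb ⊢
      rw [MonoidAlgebra.comul_single]
      simp only [CommSemiring.comul_apply, TensorProduct.map_tmul, LinearMap.mul'_apply]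
      exact congrArg₂ _ ha.symm hb.symm)

theorem ofValues_basis (a : ℤ × Fin 2 → k) (p : ℤ × Fin 2) :
    (ofValues k a).ofConv (basis k p) = a p :=
  (basis k).constr_basis k a p

theorem ofValues_of_basis (f : WithConv (MonoidAlgebra k D →ₗ[k] k)) :
    ofValues k (fun p => f.ofConv (basis k p)) = f :=
  WithConv.ofConv_injective ((basis k).ext fun p => ofValues_basis _ p)

/-! ### The generators lie in the finite dual -/

/-- The homomorphism from `𝔻_∞` with `g ^ i ↦ M i` and `x ↦ X`. -/
def dihedralLift {B : Type*} [Monoid B] (M : ℤ → B) (X : B) (h0 : M 0 = 1)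
    (hadd : ∀ i j, M (i + j) = M i * M j) (hX : X * X = 1) (hinv : ∀ i, M i * X = X * M (-i)) :
    D →* B where
  toFun
    | .r i => M i
    | .sr i => X * M i
  map_one' := h0
  map_mul' := by
    have hXM (i j : ℤ) : M i * (X * M j) = X * M (j - i) := by
      rw [← mul_assoc, hinv, mul_assoc, ← hadd, neg_add_eq_sub]
    have hXX (i j : ℤ) : X * M i * (X * M j) = M (j - i) := by
      rw [mul_assoc, hXM, ← mul_assoc, hX, one_mul]
    rintro (i | i) (j | j)
    · exact hadd i j
    · exact (hXM i j).symm
    · exact (congrArg (X * ·) (hadd i j)).trans (mul_assoc _ _ _).symm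
    · exact (hXX i j).symm

/-- Coefficients of finite-dimensional representations `g ^ i ↦ M i`, `x ↦ X` lie in the finite
dual. -/
theorem ofValues_mem_finiteDual {B : Type*} [Ring B] [Algebra k B] [FiniteDimensional k B]
    (M : ℤ → B) (X : B) (h0 : M 0 = 1) (hadd : ∀ i j, M (i + j) = M i * M j) (hX : X * X = 1)
    (hinv : ∀ i, M i * X = X * M (-i)) (ℓ : B →ₗ[k] k) (a : ℤ × Fin 2 → k)
    (ha0 : ∀ i, ℓ (M i) = a (i, 0)) (ha1 : ∀ i, ℓ (M i * X) = a (i, 1)) :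
    ofValues k a ∈ finiteDual k (MonoidAlgebra k D) := by
  refine mem_finiteDual_of_algHom
    (MonoidAlgebra.lift k B D (dihedralLift M X h0 hadd hX hinv)) ℓ ((basis k).ext fun p => ?_)
  rw [ofValues_basis]
  obtain ⟨i, j⟩ := p
  rw [LinearMap.comp_apply, AlgHom.toLinearMap_apply, basis_apply, MonoidAlgebra.lift_of]
  fin_cases j
  · have h : g ^ i * x ^ 0 = DihedralGroup.r (n := 0) i := by rw [pow_zero, mul_one, g_zpow]
    exact (ha0 i).symm.trans (congrArg (fun d => ℓ (dihedralLift M X h0 hadd hX hinv d)) h.symm)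
  · have h : g ^ i * x ^ 1 = DihedralGroup.sr (n := 0) (-i : ℤ) := by rw [pow_one, g_zpow_mul_x]
    refine (ha1 i).symm.trans ?_
    rw [hinv]
    exact congrArg (fun d => ℓ (dihedralLift M X h0 hadd hX hinv d)) h.symm

/-- `E` is the upper right coefficient of `g ↦ (1 1; 0 1)`, `x ↦ diag (-1, 1)`. -/
theorem E_mem_finiteDual : E k ∈ finiteDual k (MonoidAlgebra k D) := by
  refine ofValues_mem_finiteDual (B := Matrix (Fin 2) (Fin 2) k)
    (fun i => !![1, (i : k); 0, 1]) !![-1, 0; 0, 1] ?_ ?_ ?_ ?_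
    (Matrix.entryLinearMap k k 0 1) _ ?_ ?_
  · simp [Matrix.one_fin_two]
  · intro i j
    simp [add_comm]
  · simp [Matrix.one_fin_two]
  · simp
  · simp
  · simp

/-- The representation `g ↦ diag (c, c⁻¹)`, `x ↦ (0 1; 1 0)` has the coefficients
`g ^ i * x ^ j ↦ c ^ i` for `j = 0` only and for `j = 1` only; `Φ c` and `Ψ c` combine them. -/
theorem diagonal_coeff_mem_finiteDual (c : kˣ) (s : k) :
    ofValues k (fun p => if p.2 = 0 then (c : k) ^ p.1 else s * (c : k) ^ p.1) ∈
      finiteDual k (MonoidAlgebra k D) := by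
  refine ofValues_mem_finiteDual (B := Matrix (Fin 2) (Fin 2) k)
    (fun i => !![(c : k) ^ i, 0; 0, (c : k) ^ (-i)]) !![0, 1; 1, 0] ?_ ?_ ?_ ?_
    (Matrix.entryLinearMap k k 0 0 + s • Matrix.entryLinearMap k k 0 1) _ ?_ ?_
  · simp [Matrix.one_fin_two]
  · intro i j
    simp [zpow_add₀ c.ne_zero, mul_comm]
  · simp [Matrix.one_fin_two]
  · simp
  · simp
  · simp

theorem Φ_mem_finiteDual (c : kˣ) : Φ c ∈ finiteDual k (MonoidAlgebra k D) := by
  have h := diagonal_coeff_mem_finiteDual c 1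
  simp only [one_mul, ite_self] at h
  exact h

theorem Ψ_mem_finiteDual (c : kˣ) : Ψ c ∈ finiteDual k (MonoidAlgebra k D) := by
  have h := diagonal_coeff_mem_finiteDual c (-1)
  simp only [neg_one_mul] at h
  exact h

/-! ### The generators generate -/

variable (k) in
/-- The subalgebra generated by `E` and all `Φ c`, `Ψ c`. -/
abbrev generated : Subalgebra k (WithConv (MonoidAlgebra k D →ₗ[k] k)) :=
  Algebra.adjoin k ({E k} ∪ Set.range (Φ (k := k)) ∪ Set.range (Ψ (k := k)))

theorem E_mem_generated : E k ∈ generated k :=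
  Algebra.subset_adjoin (Or.inl (Or.inl rfl))

theorem Φ_mem_generated (c : kˣ) : Φ c ∈ generated k :=
  Algebra.subset_adjoin (Or.inl (Or.inr ⟨c, rfl⟩))

theorem Ψ_mem_generated (c : kˣ) : Ψ c ∈ generated k :=
  Algebra.subset_adjoin (Or.inr ⟨c, rfl⟩)

theorem ofValues_expPoly_mem_generated {a : ℤ → k} (ha : a ∈ expPoly k) :
    ofValues k (fun p => a p.1) ∈ generated k := by
  have hle : expPoly k ≤ (Subalgebra.toSubmodule (generated k)).comap
      ((ofValues k).toLinearMap ∘ₗ LinearMap.funLeft k k Prod.fst) := by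
    refine Submodule.span_le.mpr ?_
    rintro _ ⟨⟨m, c⟩, rfl⟩
    have h : ofValues k (fun p => fallingExp m c p.1) =
        aeval (E k) (descPochhammer k m) * Φ c := by
      rw [show E k = ofValues k fun p => (p.1 : k) from rfl,
        show Φ c = ofValues k fun p => (c : k) ^ p.1 from rfl, aeval_algHom_apply, ← map_mul]
      congr 1
      ext p
      simp [fallingExp, aeval_pi_apply]
    change ofValues k (fun p => fallingExp m c p.1) ∈ generated k
    rw [h]
    have hE : Algebra.adjoin k {E k} ≤ generated k :=
      Algebra.adjoin_le (Set.singleton_subset_iff.mpr E_mem_generated)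
    exact mul_mem (hE (aeval_mem_adjoin_singleton k (E k))) (Φ_mem_generated c)
  exact hle ha

/-- The indicator of the coset `j` is `(Φ 1 + Ψ 1) / 2` for `j = 0` and `(Φ 1 - Ψ 1) / 2` for
`j = 1`. -/
theorem ofValues_indicator_mem_generated [CharZero k] (j : Fin 2) :
    ofValues k (fun p => if p.2 = j then 1 else 0) ∈ generated k := by
  have h (s : k) (hs : s = if j = 0 then 1 else -1) :
      ofValues k (fun p => if p.2 = j then 1 else 0) =
      (2⁻¹ : k) • (Φ 1 + s • Ψ 1) := by
    rw [show Φ 1 = ofValues k fun p => ((1 : kˣ) : k) ^ p.1 from rfl,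
        show Ψ 1 = ofValues k fun p =>
          if p.2 = 0 then ((1 : kˣ) : k) ^ p.1 else -((1 : kˣ) : k) ^ p.1 from rfl,
        ← map_smul, ← map_add, ← map_smul]
    congr 1
    ext ⟨i, j'⟩
    subst hs
    fin_cases j <;> fin_cases j' <;> simp <;> norm_num
  rw [h _ rfl]
  exact Subalgebra.smul_mem _ (add_mem (Φ_mem_generated 1)
    (Subalgebra.smul_mem _ (Ψ_mem_generated 1) _)) _

/-- The values of `f ∈ (k 𝔻_∞)°` along `i ↦ g ^ i * x ^ j` satisfy the recurrence given by the
minimal polynomial of `g` in a finite-dimensional quotient. -/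
theorem orbit_mem_expPoly [IsAlgClosed k] [CharZero k]
    {f : WithConv (MonoidAlgebra k D →ₗ[k] k)} (hf : f ∈ finiteDual k (MonoidAlgebra k D))
    (j : Fin 2) : (fun i => f.ofConv (basis k (i, j))) ∈ expPoly k := by
  obtain ⟨I, hI, hfin, hfI⟩ := hf
  let u : (MonoidAlgebra k D)ˣ := (toUnits g).map (MonoidAlgebra.of k D)
  let π := Ideal.Quotient.mkₐ k I
  have hint : IsIntegral k (π u) := IsIntegral.of_finite k _
  apply mem_expPoly_of_aeval_shift_eq_zero (minpoly.monic hint)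
  have hp : aeval (u : MonoidAlgebra k D) (minpoly k (π u)) ∈ I := by
    rw [← Ideal.Quotient.eq_zero_iff_mem]
    exact (aeval_algHom_apply π _ _).symm.trans (minpoly.aeval k _)
  have hb (i : ℤ) : basis k (i, j) = ↑(u ^ i) * MonoidAlgebra.of k D (x ^ (j : ℕ)) := by
    rw [basis_apply, map_mul]
    congr 1
    simp only [u, ← map_zpow]
    rfl
  ext i
  simp only [hb]
  rw [aeval_shift_orbit]
  exact hfI _ (I.mul_mem_right _ hp)

theorem finiteDual_le_generated [IsAlgClosed k] [CharZero k] :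
    finiteDual k (MonoidAlgebra k D) ≤ generated k := by
  intro f hf
  have h : f = ofValues k (fun p => f.ofConv (basis k (p.1, 0))) *
        ofValues k (fun p => if p.2 = 0 then 1 else 0) +
      ofValues k (fun p => f.ofConv (basis k (p.1, 1))) *
        ofValues k (fun p => if p.2 = 1 then 1 else 0) := by
    rw [← map_mul, ← map_mul, ← map_add]
    conv_lhs => rw [← ofValues_of_basis f]
    congr 1
    ext ⟨i, j⟩
    fin_cases j <;> simp
  have hmem (j : Fin 2) := mul_mem (ofValues_expPoly_mem_generated (orbit_mem_expPoly hf j))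
    (ofValues_indicator_mem_generated j)
  rw [h]
  exact add_mem (hmem 0) (hmem 1)

end InfiniteDihedral

end

theorem proposition3p4 (k : Type*) [Field k] [IsAlgClosed k] [CharZero k] :
    Algebra.adjoin k
        ({InfiniteDihedral.E k} ∪ Set.range (InfiniteDihedral.Φ (k := k)) ∪
          Set.range (InfiniteDihedral.Ψ (k := k))) =
      finiteDual k (MonoidAlgebra k InfiniteDihedral.D) := by
  refine le_antisymm (Algebra.adjoin_le ?_) InfiniteDihedral.finiteDual_le_generated
  rintro _ ((rfl | ⟨c, rfl⟩) | ⟨c, rfl⟩)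
  · exact InfiniteDihedral.E_mem_finiteDual
  · exact InfiniteDihedral.Φ_mem_finiteDual c
  · exact InfiniteDihedral.Ψ_mem_finiteDual c
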